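/- Let $p$ be a prime and $m\ge 1$ an integer with $p>3$ or $m>2$. Put $G=\mathbb F_{p^m}$ and $n=p^m-1$, and let $\beta$ be a primitive element of $G$. For a cyclic code $C\subseteq\mathbb F_p[x]/(x^n-1)$ with generator polynomial $g\mid x^n-1$, the defining set is $T=\{0\le i<n : g(\beta^i)=0\}$. The extended code $\hat C\subseteq\mathbb F_p^{G}$ consists of the words $(x_h)_{h\in G}$ with $(x_{\beta^0},\dots,x_{\beta^{n-1}})\in C$ and $x_0=-\sum_{h\ne0}x_h$. Call $\hat C$ an *extended maximal affine-invariant code* if $T$ is a single cyclotomic class $Cl(j)=\{jp^l \bmod n: l\ge 0\}$ and $\hat C$ is invariant under all coordinate permutations $h\mapsto ah+b$ with $a\in G^*$, $b\in G$. An $[[N,k,d]]_p$ quantum code is a stabilizer code $Q\subseteq(\mathbb C^p)^{\otimes N}$ of dimension $p^k$ and minimum distance exactly $d$. It is pure if every error operator $X(a)Z(b)$ of weight strictly between $0$ and $d$ maps $Q$ into $Q^\perp$. For $k=0$ the minimum distance is, as usual, the largest $d$ such that $Q$ is pure to $d$ in this sense. Then extended maximal affine-invariant codes exist, and for each such code $\hat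 C$, with minimum distance $d_A$: 1. There is a pure quantum code with parameters $[[p^m,\;p^m-2-2m,\;d_Q]]_p$ such that $m+2\ge d_Q=d_A$. 2. $\hat C$ is the extended narrow-sense BCH code of designed distance $2$ (that is, its defining set is $Cl(1)$ for a suitable choice of $\beta$), and the minimum distance of its Euclidean dual $\hat C^{\perp}$ is $p^m-p^{m-1}$ or $p^m-p^{m-1}+1$. -/

import Mathlib

/-! ### Classical codes: minimum distance and Euclidean dual -/

section Classical

variable {ι K : Type*} [Fintype ι] [Field K]

/-- `d` is the minimum distance of the linear code `C`: the least Hamming weight of a nonzero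
codeword.  (A zero code has no minimum distance.) -/
def HasMinDistance [DecidableEq K] (C : Submodule K (ι → K)) (d : ℕ) : Prop :=
  IsLeast {w : ℕ | ∃ x ∈ C, x ≠ 0 ∧ hammingNorm x = w} d

/-- The Euclidean dual code `C^⊥`. -/
def euclideanDual (C : Submodule K (ι → K)) : Submodule K (ι → K) where
  carrier := {y | ∀ x ∈ C, ∑ i, x i * y i = 0}
  zero_mem' := by intro x _; simp
  add_mem' := by
    intro y z hy hz x hx
    simp [mul_add, Finset.sum_add_distrib, hy x hx, hz x hx]
  smul_mem' := by
    intro c y hy x hx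
    have h : ∑ i, x i * (c • y) i = c * ∑ i, x i * y i := by
      rw [Finset.mul_sum]
      exact Finset.sum_congr rfl fun i _ => by simp only [Pi.smul_apply, smul_eq_mul]; ring
    rw [h, hy x hx, mul_zero]

end Classical

/-! ### Primitive cyclic codes and their extensions

`K = 𝔽_q` is a finite field, `G` a finite extension of it, and `n = |G| - 1`. -/

section Cyclic

open Polynomial

/-- The cyclic code of length `n` generated by `g` (for `g ∣ X ^ n - 1`): the word
`(c_0, …, c_{n-1})` is identified with the class of `∑ c_i X ^ i` in `K[X] / (X ^ n - 1)`, and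
it lies in the ideal generated by `g` iff `g` divides `∑ c_i X ^ i`. -/
noncomputable def cyclicCode (K : Type*) [Field K] (n : ℕ) (g : K[X]) :
    Submodule K (Fin n → K) where
  carrier := {c | g ∣ ∑ i : Fin n, C (c i) * X ^ (i : ℕ)}
  zero_mem' := by simp
  add_mem' := by
    intro c d hc hd
    have h := dvd_add hc hd
    rw [← Finset.sum_add_distrib] at h
    simpa [add_mul] using h
  smul_mem' := by
    intro a c hc
    have h := Dvd.dvd.mul_left hc (C a)
    rw [Finset.mul_sum] at h
    simpa [mul_assoc] using h

/-- The defining set `{0 ≤ i < n | g (β ^ i) = 0}`. -/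
def definingSet {K G : Type*} [Field K] [Field G] [Algebra K G] (n : ℕ) (β : G) (g : K[X]) :
    Set ℕ :=
  {i | i < n ∧ aeval (β ^ i) g = 0}

/-- The `q`-cyclotomic class `Cl(j) = {j q ^ l mod n}`, for `q` prime to `n` (so that nonnegative
exponents `l` suffice). -/
def cyclotomicClass (q n j : ℕ) : Set ℕ :=
  {s | s < n ∧ ∃ l : ℕ, s ≡ j * q ^ l [MOD n]}

/-- The extension of a code `D` of length `n = |G| - 1` by an overall parity check.  The
coordinate `i` of `D` is labelled by `β ^ i`, where `β` is a primitive `n`-th root of unity of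
`G`, and the additional coordinate is labelled by `0 ∈ G`. -/
def extendedCode {K G : Type*} [Field K] [Field G] {n : ℕ} (β : G)
    (D : Submodule K (Fin n → K)) : Submodule K (G → K) where
  carrier := {x | (fun i : Fin n => x (β ^ (i : ℕ))) ∈ D ∧ x 0 = -∑ i : Fin n, x (β ^ (i : ℕ))}
  zero_mem' := by
    refine ⟨?_, by simp⟩
    exact D.zero_mem
  add_mem' := by
    rintro x y ⟨hx, hx0⟩ ⟨hy, hy0⟩
    refine ⟨D.add_mem hx hy, ?_⟩
    simp only [Pi.add_apply, Finset.sum_add_distrib, hx0, hy0]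
    ring
  smul_mem' := by
    rintro a x ⟨hx, hx0⟩
    refine ⟨D.smul_mem a hx, ?_⟩
    simp only [Pi.smul_apply, smul_eq_mul, ← Finset.mul_sum, hx0]
    ring

/-- `E` is the extended cyclic code, in `K ^ G`, of the primitive cyclic code of length
`|G| - 1` whose defining set with respect to the primitive root of unity `β` is `T`. -/
def IsExtendedCyclicCode {K G : Type*} [Field K] [Field G] [Algebra K G] (β : G) (T : Set ℕ)
    (E : Submodule K (G → K)) : Prop :=
  IsPrimitiveRoot β (Nat.card G - 1) ∧
    ∃ g : K[X], g ∣ X ^ (Nat.card G - 1) - 1 ∧ definingSet (Nat.card G - 1) β g = T ∧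
      E = extendedCode β (cyclicCode K (Nat.card G - 1) g)

/-- The permutation group of `E` contains `AGL(1, G) = {X ↦ a X + b, a ≠ 0}`. -/
def IsAffineInvariant {K G : Type*} [Field K] [Field G] (E : Submodule K (G → K)) : Prop :=
  ∀ a b : G, a ≠ 0 → ∀ x ∈ E, (fun g : G => x (a * g + b)) ∈ E

/-- Extended maximal affine-invariant codes: affine-invariant extended cyclic codes whose
defining set is a single cyclotomic class. -/
def IsMaximalAffineInvariantCode {K G : Type*} [Field K] [Field G] [Algebra K G]
    (E : Submodule K (G → K)) : Prop :=
  (∃ (β : G) (j : ℕ), j < Nat.card G - 1 ∧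
      IsExtendedCyclicCode β (cyclotomicClass (Nat.card K) (Nat.card G - 1) j) E) ∧
    IsAffineInvariant E

/-- Extended (narrow-sense, primitive) BCH codes of designed distance `δ`: the defining set is
`Cl(1) ∪ ⋯ ∪ Cl(δ - 1)`. -/
def IsExtendedBCHCode {K G : Type*} [Field K] [Field G] [Algebra K G] (δ : ℕ)
    (E : Submodule K (G → K)) : Prop :=
  ∃ β : G, IsExtendedCyclicCode β
    {s | ∃ i, 1 ≤ i ∧ i < δ ∧ s ∈ cyclotomicClass (Nat.card K) (Nat.card G - 1) i} E

end Cyclic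

/-! ### Quantum codes over qudits of prime dimension `p` -/

section Quantum

open scoped InnerProductSpace

variable {p : ℕ} [NeZero p] {ι : Type*} [Fintype ι] [DecidableEq ι]

/-- The state space `(ℂ ^ p) ^ {⊗ ι}` of a family of `p`-level systems indexed by `ι`, with
orthonormal basis `|x⟩`, `x ∈ 𝔽_p ^ ι`. -/
abbrev QuditSpace (p : ℕ) [NeZero p] (ι : Type*) [Fintype ι] [DecidableEq ι] : Type _ :=
  EuclideanSpace ℂ (ι → ZMod p)

/-- The error operator `X(a) Z(b)`, where `X(a)|x⟩ = |x + a⟩`, `Z(b)|x⟩ = ω ^ (b · x) |x⟩` and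
`ω = exp (2 π i / p)`. -/
noncomputable def errorOp (a b : ι → ZMod p) : QuditSpace p ι →ₗ[ℂ] QuditSpace p ι where
  toFun ψ := WithLp.toLp 2 fun x => ZMod.stdAddChar (∑ i, b i * (x i - a i)) * ψ (x - a)
  map_add' := by
    intro ψ φ
    ext x
    simp [mul_add]
  map_smul' := by
    intro c ψ
    ext x
    simp [mul_left_comm]

/-- The weight of `X(a) Z(b)`: the number of tensor factors on which it is not a scalar. -/
def errorWeight (a b : ι → ZMod p) : ℕ :=
  (Finset.univ.filter fun i => a i ≠ 0 ∨ b i ≠ 0).card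

/-- Detectability of an operator by a code (Knill-Laflamme condition `P E P = c P`). -/
def Detects (Q : Submodule ℂ (QuditSpace p ι)) (E : QuditSpace p ι →ₗ[ℂ] QuditSpace p ι) :
    Prop :=
  ∃ c : ℂ, ∀ u ∈ Q, ∀ v ∈ Q, ⟪u, E v⟫_ℂ = c * ⟪u, v⟫_ℂ

/-- `Q` is pure to `d`: errors of weight strictly between `0` and `d` map `Q` to a space
orthogonal to `Q`. -/
def IsPureTo (Q : Submodule ℂ (QuditSpace p ι)) (d : ℕ) : Prop :=
  ∀ a b : ι → ZMod p, 0 < errorWeight a b → errorWeight a b < d →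
    ∀ u ∈ Q, ∀ v ∈ Q, ⟪u, errorOp a b v⟫_ℂ = 0

/-- `Q` detects all errors of weight less than `d`.  As is usual, a one-dimensional code (which
trivially detects every error) is moreover required to be pure to `d`. -/
def HasQuantumDistanceAtLeast (Q : Submodule ℂ (QuditSpace p ι)) (d : ℕ) : Prop :=
  (∀ a b : ι → ZMod p, errorWeight a b < d → Detects Q (errorOp a b)) ∧
    (Module.finrank ℂ Q = 1 → IsPureTo Q d)

/-- The minimum distance of a quantum code is exactly `d`. -/
def HasQuantumDistance (Q : Submodule ℂ (QuditSpace p ι)) (d : ℕ) : Prop :=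
  IsGreatest {e : ℕ | HasQuantumDistanceAtLeast Q e} d

/-- `Q` is a stabilizer code: a nonzero space of the vectors fixed by a set of pairwise commuting
error operators `c X(a) Z(b)`, `|c| = 1` (equivalently, by the abelian group they generate). -/
def IsStabilizerCode (Q : Submodule ℂ (QuditSpace p ι)) : Prop :=
  Q ≠ ⊥ ∧ ∃ S : Set (QuditSpace p ι →ₗ[ℂ] QuditSpace p ι),
    (∀ E ∈ S, ∃ (c : ℂ) (a b : ι → ZMod p), ‖c‖ = 1 ∧ E = c • errorOp a b) ∧
    (∀ E ∈ S, ∀ F ∈ S, Commute E F) ∧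
    ∀ ψ : QuditSpace p ι, ψ ∈ Q ↔ ∀ E ∈ S, E ψ = ψ

/-- `Q` is an `[[n, k, d]]_p` quantum code: a stabilizer code of length `n`, dimension `p ^ k` and
minimum distance `d`. -/
structure IsQuantumCode (Q : Submodule ℂ (QuditSpace p ι)) (n k d : ℕ) : Prop where
  length : Fintype.card ι = n
  stabilizer : IsStabilizerCode Q
  dimension : Module.finrank ℂ Q = p ^ k
  distance : HasQuantumDistance Q d

/-- A quantum code is pure if it is pure to its minimum distance. -/
def IsPureQuantumCode (Q : Submodule ℂ (QuditSpace p ι)) : Prop :=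
  ∃ d, HasQuantumDistance Q d ∧ IsPureTo Q d

end Quantum

/-! Up to the choice of `β` there is only one code to study. Let `C` (`affineCheckCode`) consist of
the words with `∑ x_h = 0` and `∑ x_h h = 0`, and let `D` (`affineFunctionCode`) be the code of
affine functions, so that each is the dual of the other. For an affine-invariant `E` with defining
set `Cl(j)`, the sum `∑ x_h (h + b)^j` vanishes for all `b`. Once the `p`-part of `j` is removed,
this is a polynomial identity in `b`, and one of its coefficients yields `∑ x_h h = 0`. So `E ≤ C`,
and counting dimensions gives `E = C` (`eq_affineCheckCode`).

A nonconstant affine function has equal fibres, which gives the dual distance `p^m - p^(m-1)`.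
Polynomials of degree at most 2 sum to zero over `G` when `p > 3` or `m > 2`, hence `D ≤ C` and the
CSS construction applies. It gives dimension `p^(dim C - dim D)` and purity up to the distance of
`C`, which is 3 for odd `p` and 4 for `p = 2`. The distance is exact because a lightest word of `C`
lies outside `D`, except for `p = 2`, `m = 3`; there `C = D`, and the purity convention for `k = 0`
decides. -/

section AffineCode

/-! ### The code of affine functions and its dual. -/

variable (p : ℕ) (G : Type*) [Field G] [Fintype G] [Algebra (ZMod p) G]

/-- The parity checks `x ↦ (∑ x_h, ∑ x_h h)`. -/
noncomputable def affineCheck : (G → ZMod p) →ₗ[ZMod p] ZMod p × G where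
  toFun x := (∑ h, x h, ∑ h, x h • h)
  map_add' x y := by simp [Finset.sum_add_distrib, add_smul]
  map_smul' c x := by simp [Finset.mul_sum, Finset.smul_sum, mul_smul]

/-- The words orthogonal to all affine functions `G → 𝔽_p`. -/
noncomputable def affineCheckCode : Submodule (ZMod p) (G → ZMod p) :=
  LinearMap.ker (affineCheck p G)

/-- The affine function `h ↦ c + φ h`. -/
def affineFunction : (ZMod p × Module.Dual (ZMod p) G) →ₗ[ZMod p] (G → ZMod p) where
  toFun y h := y.1 + y.2 h
  map_add' x y := by ext h; simp; ring
  map_smul' c x := by ext h; simp; ring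

/-- The code of all affine functions `G → 𝔽_p` (a generalized Reed-Muller code of order `1`). -/
def affineFunctionCode : Submodule (ZMod p) (G → ZMod p) :=
  LinearMap.range (affineFunction p G)

variable {p G}

omit [Fintype G] in
theorem mem_affineFunctionCode {y : G → ZMod p} :
    y ∈ affineFunctionCode p G ↔
      ∃ (c : ZMod p) (φ : Module.Dual (ZMod p) G), y = fun h => c + φ h := by
  constructor
  · rintro ⟨⟨c, φ⟩, rfl⟩
    exact ⟨c, φ, rfl⟩
  · rintro ⟨c, φ, rfl⟩
    exact ⟨(c, φ), rfl⟩

theorem mem_affineCheckCode {x : G → ZMod p} :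
    x ∈ affineCheckCode p G ↔ ∑ h, x h = 0 ∧ ∑ h, x h • h = 0 := by
  rw [affineCheckCode, LinearMap.mem_ker]
  exact Prod.mk_eq_zero

theorem affineCheck_surjective : Function.Surjective (affineCheck p G) := by
  classical
  rintro ⟨c, g⟩
  refine ⟨Pi.single g 1 + Pi.single 0 (c - 1), ?_⟩
  simp [affineCheck, Finset.sum_add_distrib, add_smul, Pi.single_apply, ite_smul]

variable [Fact p.Prime]

theorem finrank_of_card_eq {m : ℕ} (hG : Fintype.card G = p ^ m) :
    Module.finrank (ZMod p) G = m := by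
  rw [Module.card_eq_pow_finrank (K := ZMod p), ZMod.card] at hG
  exact Nat.pow_right_injective (Fact.out : p.Prime).two_le hG

theorem finrank_affineCheckCode :
    Module.finrank (ZMod p) (affineCheckCode p G) + (1 + Module.finrank (ZMod p) G) =
      Fintype.card G := by
  have h := LinearMap.finrank_range_add_finrank_ker (affineCheck p G)
  rw [LinearMap.range_eq_top.2 affineCheck_surjective, finrank_top, Module.finrank_prod,
    Module.finrank_self, Module.finrank_fintype_fun_eq_card] at h
  rw [affineCheckCode, ← h, add_comm]

theorem finrank_affineFunctionCode :
    Module.finrank (ZMod p) (affineFunctionCode p G) = 1 + Module.finrank (ZMod p) G := by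
  have hinj : Function.Injective (affineFunction p G) := by
    rw [← LinearMap.ker_eq_bot, LinearMap.ker_eq_bot']
    rintro ⟨c, φ⟩ h
    have hc : c = 0 := by simpa [affineFunction] using congrFun h 0
    refine Prod.ext hc (LinearMap.ext fun g => ?_)
    simpa [affineFunction, hc] using congrFun h g
  rw [affineFunctionCode, LinearMap.finrank_range_of_inj hinj, Module.finrank_prod,
    Module.finrank_self, Subspace.dual_finrank_eq]

theorem sum_affine_mul (x : G → ZMod p) (c : ZMod p) (φ : Module.Dual (ZMod p) G) :
    ∑ h, (c + φ h) * x h = c * ∑ h, x h + φ (∑ h, x h • h) := by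
  simp only [add_mul, Finset.sum_add_distrib, Finset.mul_sum, map_sum, map_smul, smul_eq_mul]
  congr 1
  exact Finset.sum_congr rfl fun h _ => mul_comm _ _

theorem mem_affineCheckCode_iff_forall {x : G → ZMod p} :
    x ∈ affineCheckCode p G ↔ ∀ d ∈ affineFunctionCode p G, ∑ h, d h * x h = 0 := by
  rw [mem_affineCheckCode]
  constructor
  · rintro ⟨h1, h2⟩ d hd
    obtain ⟨c, φ, rfl⟩ := mem_affineFunctionCode.1 hd
    rw [sum_affine_mul, h1, h2, mul_zero, map_zero, add_zero]
  · intro h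
    constructor
    · simpa using h _ (mem_affineFunctionCode.2 ⟨1, 0, rfl⟩)
    · rw [← Module.forall_dual_apply_eq_zero_iff (ZMod p)]
      intro φ
      have h1 := h _ (mem_affineFunctionCode.2 ⟨0, φ, rfl⟩)
      rwa [sum_affine_mul, zero_mul, zero_add] at h1

theorem euclideanDual_affineCheckCode :
    euclideanDual (affineCheckCode p G) = affineFunctionCode p G := by
  classical
  ext y
  constructor
  · intro hy
    -- The four-point words `δ_{u+v} - δ_u - δ_v + δ_0` lie in the code. Orthogonality to them says
    -- that `y - y 0` is additive, hence `𝔽_p`-linear.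
    have hadd : ∀ u v, y (u + v) - y 0 = (y u - y 0) + (y v - y 0) := by
      intro u v
      have hx : Pi.single (u + v) 1 - Pi.single u 1 - Pi.single v 1 + Pi.single 0 1 ∈
          affineCheckCode p G := by
        rw [mem_affineCheckCode]
        simp [Finset.sum_add_distrib, Finset.sum_sub_distrib, add_smul, sub_smul, Pi.single_apply,
          ite_smul]
      have h := hy _ hx
      simp only [Pi.add_apply, Pi.sub_apply, add_mul, sub_mul, Finset.sum_add_distrib,
        Finset.sum_sub_distrib, Pi.single_apply, ite_mul, one_mul, zero_mul, Finset.sum_ite_eq',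
        Finset.mem_univ, if_true] at h
      linear_combination h
    let φ : G →+ ZMod p := AddMonoidHom.mk' (fun u => y u - y 0) hadd
    refine mem_affineFunctionCode.2 ⟨y 0, φ.toZModLinearMap p, ?_⟩
    ext h
    change y h = y 0 + (y h - y 0)
    ring
  · intro hy x hx
    have h := mem_affineCheckCode_iff_forall.1 hx y hy
    simpa only [mul_comm] using h

/-- Reindexing `∑ θ h * f h` by the period `k` changes it by `θ k * ∑ f h`, so this product is zero;
choose `θ` with `θ k ≠ 0`. -/
theorem sum_eq_zero_of_periodic {f : G → ZMod p} {k : G} (hk : k ≠ 0)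
    (hf : ∀ h, f (h + k) = f h) : ∑ h, f h = 0 := by
  obtain ⟨θ, hθ⟩ : ∃ θ : Module.Dual (ZMod p) G, θ k ≠ 0 := by
    by_contra! h
    exact hk ((Module.forall_dual_apply_eq_zero_iff (ZMod p) k).1 h)
  have h1 : ∑ h, θ h * f h = ∑ h, θ h * f h + θ k * ∑ h, f h := by
    conv_lhs => rw [← Equiv.sum_comp (Equiv.addRight k)]
    simp only [Equiv.coe_addRight, hf, map_add, add_mul, Finset.sum_add_distrib, Finset.mul_sum]
  have h2 : θ k * ∑ h, f h = 0 := by linear_combination -h1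
  exact (mul_eq_zero.1 h2).resolve_left hθ

theorem exists_ne_zero_of_two_lt_finrank (hG : 2 < Module.finrank (ZMod p) G)
    (φ ψ : Module.Dual (ZMod p) G) : ∃ k, k ≠ 0 ∧ φ k = 0 ∧ ψ k = 0 := by
  have h : LinearMap.ker (φ.prod ψ) ≠ ⊥ := LinearMap.ker_ne_bot_of_finrank_lt (by
    rwa [Module.finrank_prod, Module.finrank_self])
  obtain ⟨k, hk, hk0⟩ := (Submodule.ne_bot_iff _).1 h
  rw [LinearMap.ker_prod] at hk
  exact ⟨k, hk0, hk.1, hk.2⟩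

/-- For `p > 3`, the substitution `h ↦ 2h` multiplies the sum by 4, and 3 is invertible. In
dimension above 2, two functionals share a nonzero kernel vector, which is a period. -/
theorem sum_dual_mul_dual (hG : 3 < p ∨ 2 < Module.finrank (ZMod p) G)
    (φ ψ : Module.Dual (ZMod p) G) : ∑ h, φ h * ψ h = 0 := by
  rcases hG with hp | hG
  · have h2 : (2 : ZMod p) ≠ 0 := by
      have : ((2 : ℕ) : ZMod p) ≠ 0 := by
        rw [Ne, ZMod.natCast_eq_zero_iff]
        exact fun h => absurd (Nat.le_of_dvd two_pos h) (by omega)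
      exact_mod_cast this
    have h3 : (3 : ZMod p) ≠ 0 := by
      have : ((3 : ℕ) : ZMod p) ≠ 0 := by
        rw [Ne, ZMod.natCast_eq_zero_iff]
        exact fun h => absurd (Nat.le_of_dvd three_pos h) (by omega)
      exact_mod_cast this
    have h1 : ∑ h, φ h * ψ h = 4 * ∑ h, φ h * ψ h := by
      conv_lhs => rw [← Equiv.sum_comp (LinearEquiv.smulOfNeZero (ZMod p) G (2 : ZMod p) h2).toEquiv]
      rw [Finset.mul_sum]
      refine Finset.sum_congr rfl fun h _ => ?_
      change φ ((2 : ZMod p) • h) * ψ ((2 : ZMod p) • h) = _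
      rw [map_smul, map_smul, smul_eq_mul, smul_eq_mul]
      ring
    have h4 : 3 * ∑ h, φ h * ψ h = 0 := by linear_combination -h1
    exact (mul_eq_zero.1 h4).resolve_left h3
  · obtain ⟨k, hk, h1, h2⟩ := exists_ne_zero_of_two_lt_finrank hG φ ψ
    exact sum_eq_zero_of_periodic hk fun h => by rw [map_add, map_add, h1, h2, add_zero, add_zero]

theorem affineFunctionCode_le (hG : 3 < p ∨ 2 < Module.finrank (ZMod p) G) :
    affineFunctionCode p G ≤ affineCheckCode p G := by
  have hone : ∑ _h : G, (1 : ZMod p) = 0 := sum_eq_zero_of_periodic one_ne_zero fun _ => rfl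
  have hlin : ∀ φ : Module.Dual (ZMod p) G, ∑ h, φ h = 0 := by
    intro φ
    -- In odd characteristic `h ↦ -h` kills the sum; characteristic 2 forces dimension above 2,
    -- where a kernel vector is a period.
    by_cases h2 : (2 : ZMod p) = 0
    · have hp : ¬3 < p := fun hp => by
        have h3 : ((2 : ℕ) : ZMod p) = 0 := by exact_mod_cast h2
        exact absurd (Nat.le_of_dvd two_pos ((ZMod.natCast_eq_zero_iff _ _).1 h3)) (by omega)
      obtain ⟨k, hk, h1, -⟩ := exists_ne_zero_of_two_lt_finrank (hG.resolve_left hp) φ φ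
      exact sum_eq_zero_of_periodic hk fun h => by rw [map_add, h1, add_zero]
    · have h1 : ∑ h, φ h = -∑ h, φ h := by
        conv_lhs => rw [← Equiv.sum_comp (Equiv.neg G)]
        simp
      have h3 : 2 * ∑ h, φ h = 0 := by linear_combination h1
      exact (mul_eq_zero.1 h3).resolve_left h2
  intro y hy
  obtain ⟨c, φ, rfl⟩ := mem_affineFunctionCode.1 hy
  refine mem_affineCheckCode_iff_forall.2 fun d hd => ?_
  obtain ⟨c', ψ, rfl⟩ := mem_affineFunctionCode.1 hd
  have h1 : ∀ h, (c' + ψ h) * (c + φ h) = c' * c * 1 + c' * φ h + c * ψ h + ψ h * φ h := fun h => by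
    ring
  simp only [h1, Finset.sum_add_distrib, ← Finset.mul_sum, hone, hlin, sum_dual_mul_dual hG]
  simp

/-- The Hamming weight of a nonconstant affine function. -/
theorem hammingNorm_affine {m : ℕ} (hm : 0 < m) (hG : Fintype.card G = p ^ m) (c : ZMod p)
    {φ : Module.Dual (ZMod p) G} (hφ : φ ≠ 0) :
    hammingNorm (fun h => c + φ h) = p ^ m - p ^ (m - 1) := by
  classical
  have hsurj : Function.Surjective φ := LinearMap.surjective hφ
  have hfib : ∀ t, (Finset.univ.filter fun h => φ h = t).card =
      (Finset.univ.filter fun h => φ h = -c).card := fun t =>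
    AddMonoidHom.card_fiber_eq_of_mem_range φ (hsurj t) (hsurj (-c))
  have hcard : p * (Finset.univ.filter fun h => φ h = -c).card = p * p ^ (m - 1) := by
    have h := Finset.card_eq_sum_card_fiberwise (f := φ) (s := Finset.univ) (t := Finset.univ)
      (fun _ _ => Finset.mem_coe.2 (Finset.mem_univ _))
    rw [Finset.card_univ, hG, Finset.sum_congr rfl fun t _ => hfib t, Finset.sum_const,
      Finset.card_univ, ZMod.card, smul_eq_mul] at h
    rw [← h, ← pow_succ', Nat.sub_add_cancel hm]
  have hp := (Fact.out : p.Prime).pos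
  rw [← Nat.eq_of_mul_eq_mul_left hp hcard, ← hG, ← Finset.card_univ,
    ← Finset.card_filter_add_card_filter_not (s := Finset.univ) (fun h => φ h = -c),
    Nat.add_sub_cancel_left]
  unfold hammingNorm
  congr 1
  ext h
  simp only [Finset.mem_filter, Finset.mem_univ, true_and, eq_neg_iff_add_eq_zero, add_comm c]

theorem le_hammingNorm_of_mem_affineFunctionCode {m : ℕ} (hm : 0 < m)
    (hG : Fintype.card G = p ^ m) {y : G → ZMod p} (hy : y ∈ affineFunctionCode p G)
    (hy0 : y ≠ 0) : p ^ m - p ^ (m - 1) ≤ hammingNorm y := by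
  obtain ⟨c, φ, rfl⟩ := mem_affineFunctionCode.1 hy
  by_cases hφ : φ = 0
  · subst hφ
    have hc : c ≠ 0 := by
      rintro rfl
      exact hy0 (by ext; simp)
    have : hammingNorm (fun h : G => c + (0 : Module.Dual (ZMod p) G) h) = p ^ m := by
      simp [hammingNorm, hc, hG]
    rw [this]
    exact Nat.sub_le _ _
  · exact (hammingNorm_affine hm hG c hφ).ge

theorem hasMinDistance_affineFunctionCode {m : ℕ} (hm : 0 < m) (hG : Fintype.card G = p ^ m) :
    HasMinDistance (affineFunctionCode p G) (p ^ m - p ^ (m - 1)) := by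
  refine ⟨?_, ?_⟩
  · obtain ⟨φ, hφ⟩ : ∃ φ : Module.Dual (ZMod p) G, φ 1 ≠ 0 := by
      by_contra! h
      exact one_ne_zero ((Module.forall_dual_apply_eq_zero_iff (ZMod p) (1 : G)).1 h)
    have hφ0 : φ ≠ 0 := by
      rintro rfl
      exact hφ rfl
    refine ⟨_, mem_affineFunctionCode.2 ⟨0, φ, rfl⟩, fun h => hφ ?_,
      hammingNorm_affine hm hG 0 hφ0⟩
    simpa using congrFun h 1
  · rintro w ⟨y, hy, hy0, rfl⟩
    exact le_hammingNorm_of_mem_affineFunctionCode hm hG hy hy0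

/-- The check vectors `(1, h)` for two distinct points are linearly independent. -/
theorem three_le_hammingNorm {x : G → ZMod p} (hx : x ∈ affineCheckCode p G) (hx0 : x ≠ 0) :
    3 ≤ hammingNorm x := by
  classical
  rw [mem_affineCheckCode] at hx
  obtain ⟨h1, h2⟩ := hx
  set s := Finset.univ.filter fun h => x h ≠ 0 with hs
  have hmem : ∀ h, h ∈ s ↔ x h ≠ 0 := by simp [hs]
  have hs1 : ∑ h ∈ s, x h = 0 := by
    rw [← h1]
    exact Finset.sum_subset (Finset.subset_univ _) fun h _ hh => by simpa [hmem] using hh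
  have hs2 : ∑ h ∈ s, x h • h = 0 := by
    rw [← h2]
    refine Finset.sum_subset (Finset.subset_univ _) fun h _ hh => ?_
    have : x h = 0 := by simpa [hmem] using hh
    rw [this, zero_smul]
  change 3 ≤ s.card
  by_contra! hlt
  have hcases : s.card = 0 ∨ s.card = 1 ∨ s.card = 2 := by omega
  rcases hcases with hc | hc | hc
  · refine hx0 (funext fun h => ?_)
    have : h ∉ s := by simp [Finset.card_eq_zero.1 hc]
    simpa [hmem] using this
  · obtain ⟨a, ha⟩ := Finset.card_eq_one.1 hc
    have : x a ≠ 0 := (hmem a).1 (by simp [ha])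
    exact this (by simpa [ha] using hs1)
  · obtain ⟨a, b, hab, ha⟩ := Finset.card_eq_two.1 hc
    have hxa : x a ≠ 0 := (hmem a).1 (by simp [ha])
    rw [ha, Finset.sum_pair hab] at hs1 hs2
    rw [eq_neg_of_add_eq_zero_right hs1, neg_smul, ← sub_eq_add_neg, ← smul_sub] at hs2
    exact hab (sub_eq_zero.1 ((smul_eq_zero.1 hs2).resolve_left hxa))

theorem even_hammingNorm [Algebra (ZMod 2) G] {x : G → ZMod 2} (hx : x ∈ affineCheckCode 2 G) :
    Even (hammingNorm x) := by
  have h := (mem_affineCheckCode.1 hx).1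
  have h1 : ∑ h, x h = (hammingNorm x : ZMod 2) := by
    rw [hammingNorm, Finset.card_filter, Nat.cast_sum]
    refine Finset.sum_congr rfl fun g _ => ?_
    generalize x g = t
    revert t
    decide
  rw [h1] at h
  exact (ZMod.natCast_eq_zero_iff_even).1 h

theorem hasMinDistance_affineCheckCode_of_ne_two (hp : p ≠ 2) :
    HasMinDistance (affineCheckCode p G) 3 := by
  classical
  have h2 : (2 : ZMod p) ≠ 0 := by
    have : ((2 : ℕ) : ZMod p) ≠ 0 := by
      rw [Ne, ZMod.natCast_eq_zero_iff]
      exact fun h => hp ((Nat.prime_dvd_prime_iff_eq Fact.out Nat.prime_two).1 h)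
    exact_mod_cast this
  have h2' : (2 : G) ≠ 0 := by
    rw [← map_ofNat (algebraMap (ZMod p) G) 2]
    exact (map_ne_zero _).2 h2
  -- The second difference along `0, 1, 2`, which annihilates affine functions.
  set x : G → ZMod p := Pi.single 0 1 + Pi.single 1 (-2) + Pi.single 2 1 with hx
  have hmem : x ∈ affineCheckCode p G := by
    rw [mem_affineCheckCode]
    constructor
    · simp only [hx, Pi.add_apply, Finset.sum_add_distrib, Finset.sum_pi_single', Finset.mem_univ,
        if_true]
      ring
    · simp only [hx, Pi.add_apply, Finset.sum_add_distrib, add_smul, Pi.single_apply, ite_smul,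
        one_smul, zero_smul, Finset.sum_ite_eq', Finset.mem_univ, if_true, neg_smul, ofNat_smul_eq_nsmul,
        nsmul_eq_mul, Nat.cast_ofNat]
      ring
  have hx0 : x ≠ 0 := fun h => by
    have := congrFun h 0
    simp [hx, h2'.symm] at this
  refine ⟨⟨x, hmem, hx0, le_antisymm ?_ (three_le_hammingNorm hmem hx0)⟩, ?_⟩
  · refine (Finset.card_le_card (t := {0, 1, 2}) fun h hh => ?_).trans Finset.card_le_three
    by_contra hn
    simp only [Finset.mem_insert, Finset.mem_singleton, not_or] at hn
    simp [hx, Pi.single_apply, hn] at hh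
  · rintro w ⟨y, hy, hy0, rfl⟩
    exact three_le_hammingNorm hy hy0

theorem hasMinDistance_affineCheckCode_two [Algebra (ZMod 2) G] (hG : 2 < Fintype.card G) :
    HasMinDistance (affineCheckCode 2 G) 4 := by
  classical
  have hlow : ∀ y ∈ affineCheckCode 2 G, y ≠ 0 → 4 ≤ hammingNorm y := by
    intro y hy hy0
    have h1 := three_le_hammingNorm hy hy0
    obtain ⟨k, hk⟩ := even_hammingNorm hy
    omega
  obtain ⟨v, hv⟩ : ∃ v : G, v ∉ ({0, 1} : Finset G) := by
    by_contra! h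
    have : Fintype.card G ≤ 2 := (Finset.card_le_card fun g _ => h g).trans Finset.card_le_two
    omega
  simp only [Finset.mem_insert, Finset.mem_singleton, not_or] at hv
  have h11 : (1 : G) + 1 = 0 := by
    have := congrArg (algebraMap (ZMod 2) G) (show (1 : ZMod 2) + 1 = 0 by decide)
    simpa using this
  -- The indicator of the affine plane `{0, 1, v, v + 1}`.
  set x : G → ZMod 2 := Pi.single 0 1 + Pi.single 1 1 + Pi.single v 1 + Pi.single (v + 1) 1 with hx
  have hmem : x ∈ affineCheckCode 2 G := by
    rw [mem_affineCheckCode]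
    constructor
    · simp only [hx, Pi.add_apply, Finset.sum_add_distrib, Finset.sum_pi_single', Finset.mem_univ,
        if_true]
      decide
    · simp only [hx, Pi.add_apply, Finset.sum_add_distrib, add_smul, Pi.single_apply, ite_smul,
        one_smul, zero_smul, Finset.sum_ite_eq', Finset.mem_univ, if_true]
      linear_combination (1 + v) * h11
  have hx0 : x ≠ 0 := fun h => by
    have h3 : v + 1 ≠ 0 := fun h3 => hv.2 (by linear_combination h3 - h11)
    have := congrFun h 0
    simp [hx, Ne.symm hv.1, h3.symm] at this
  refine ⟨⟨x, hmem, hx0, le_antisymm ?_ (hlow x hmem hx0)⟩, ?_⟩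
  · refine (Finset.card_le_card (t := {0, 1, v, v + 1}) fun h hh => ?_).trans Finset.card_le_four
    by_contra hn
    simp only [Finset.mem_insert, Finset.mem_singleton, not_or] at hn
    simp [hx, Pi.single_apply, hn] at hh
  · rintro w ⟨y, hy, hy0, rfl⟩
    exact hlow y hy hy0

end AffineCode

/-! ### CSS codes: dimension, stabilizer, purity and distance. -/

section CSS

open scoped InnerProductSpace

variable {p : ℕ} {ι : Type*} [Fintype ι]

theorem errorWeight_zero_right (a : ι → ZMod p) : errorWeight a 0 = hammingNorm a := by
  simp [errorWeight, hammingNorm]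

theorem hammingNorm_le_errorWeight_left (a b : ι → ZMod p) :
    hammingNorm a ≤ errorWeight a b :=
  Finset.card_le_card fun i hi => by
    simp only [Finset.mem_filter, Finset.mem_univ, true_and] at hi ⊢
    exact Or.inl hi

theorem hammingNorm_le_errorWeight_right (a b : ι → ZMod p) :
    hammingNorm b ≤ errorWeight a b :=
  Finset.card_le_card fun i hi => by
    simp only [Finset.mem_filter, Finset.mem_univ, true_and] at hi ⊢
    exact Or.inr hi

variable [DecidableEq ι] [NeZero p]

theorem errorOp_apply (a b : ι → ZMod p) (ψ : QuditSpace p ι) (x : ι → ZMod p) :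
    errorOp a b ψ x = ZMod.stdAddChar (∑ i, b i * (x i - a i)) * ψ (x - a) := rfl

theorem errorOp_zero_zero (ψ : QuditSpace p ι) : errorOp 0 0 ψ = ψ := by
  ext x
  simp [errorOp_apply]

theorem stdAddChar_ne_one {t : ZMod p} (ht : t ≠ 0) : ZMod.stdAddChar t ≠ 1 := fun h =>
  ht (ZMod.injective_stdAddChar (h.trans (AddChar.map_zero_eq_one _).symm))

/-- The CSS code of `D ≤ C`: the states supported on `C` that are invariant under translations
by `D`. -/
def cssCode [Fact p.Prime] (C D : Submodule (ZMod p) (ι → ZMod p)) :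
    Submodule ℂ (QuditSpace p ι) where
  carrier := {ψ | (∀ x, x ∉ C → ψ x = 0) ∧ ∀ a ∈ D, ∀ x, ψ (x - a) = ψ x}
  zero_mem' := by simp
  add_mem' := by
    rintro ψ φ ⟨h1, h2⟩ ⟨h3, h4⟩
    exact ⟨fun x hx => by simp [h1 x hx, h3 x hx], fun a ha x => by simp [h2 a ha x, h4 a ha x]⟩
  smul_mem' := by
    rintro c ψ ⟨h1, h2⟩
    exact ⟨fun x hx => by simp [h1 x hx], fun a ha x => by simp [h2 a ha x]⟩

variable [Fact p.Prime] {C D : Submodule (ZMod p) (ι → ZMod p)}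

open Classical in
/-- States of a CSS code are functions on the quotient `C / D`. -/
noncomputable def cssCodeEquiv (hDC : D ≤ C) :
    cssCode C D ≃ₗ[ℂ] ((C ⧸ D.submoduleOf C) → ℂ) where
  toFun ψ q := (ψ : QuditSpace p ι) (q.out : C)
  map_add' _ _ := rfl
  map_smul' _ _ := rfl
  invFun f := ⟨WithLp.toLp 2 fun x =>
      if h : x ∈ C then f (Submodule.Quotient.mk ⟨x, h⟩) else 0, by
    refine ⟨fun x hx => by simp [hx], fun a ha x => ?_⟩
    by_cases hx : x ∈ C
    · have hxa : x - a ∈ C := C.sub_mem hx (hDC ha)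
      simp only [hx, hxa, dif_pos]
      congr 1
      rw [Submodule.Quotient.eq]
      change x - a - x ∈ D
      simpa using ha
    · have hxa : x - a ∉ C := fun h => hx (by simpa using C.add_mem h (hDC ha))
      simp [hx, hxa]⟩
  left_inv := by
    rintro ⟨ψ, h1, h2⟩
    ext x
    by_cases hx : x ∈ C
    · simp only [hx, dif_pos]
      set q : C ⧸ D.submoduleOf C := Submodule.Quotient.mk ⟨x, hx⟩ with hq
      have h : (Submodule.Quotient.mk q.out : C ⧸ D.submoduleOf C) = Submodule.Quotient.mk ⟨x, hx⟩ :=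
        Quotient.out_eq' q
      rw [Submodule.Quotient.eq] at h
      have h3 := h2 _ h (q.out : C)
      simpa using h3.symm
    · simp [hx, h1 x hx]
  right_inv f := by
    ext q
    simp only [SetLike.coe_mem, dif_pos]
    congr 1
    exact Quotient.out_eq' q

theorem finrank_cssCode (hDC : D ≤ C) :
    Module.finrank ℂ (cssCode C D) =
      p ^ (Module.finrank (ZMod p) C - Module.finrank (ZMod p) D) := by
  classical
  have : Fintype (C ⧸ D.submoduleOf C) := Fintype.ofFinite _
  rw [(cssCodeEquiv hDC).finrank_eq, Module.finrank_fintype_fun_eq_card,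
    Module.card_eq_pow_finrank (K := ZMod p), ZMod.card, Submodule.finrank_quotient,
    (Submodule.submoduleOfEquivOfLe hDC).finrank_eq]

/-- The stabilizers are `X(a) Z(b)` with `a, b ∈ D`. They commute because `D ≤ C = D^⊥`; the `Z(b)`
confine the support to `C`, and the `X(a)` impose invariance under `D`. -/
theorem cssCode_isStabilizerCode (hDC : D ≤ C)
    (hC : ∀ x, x ∈ C ↔ ∀ d ∈ D, ∑ i, d i * x i = 0) : IsStabilizerCode (cssCode C D) := by
  refine ⟨fun h => ?_, {E | ∃ a ∈ D, ∃ b ∈ D, E = errorOp a b}, ?_, ?_, fun ψ => ⟨?_, ?_⟩⟩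
  · have := finrank_cssCode hDC
    rw [h, finrank_bot] at this
    exact pow_ne_zero _ (NeZero.ne p) this.symm
  · rintro E ⟨a, -, b, -, rfl⟩
    exact ⟨1, a, b, by simp, by simp⟩
  · rintro E ⟨a, ha, b, hb, rfl⟩ F ⟨a', ha', b', hb', rfl⟩
    have h1 : ∑ i, b i * a' i = 0 := (hC a').1 (hDC ha') b hb
    have h2 : ∑ i, b' i * a i = 0 := (hC a).1 (hDC ha) b' hb'
    refine LinearMap.ext fun ψ => ?_
    ext x
    simp only [Module.End.mul_apply, errorOp_apply, Pi.sub_apply, mul_sub,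
      Finset.sum_sub_distrib, h1, h2, sub_right_comm x a a', sub_zero]
    ring
  · rintro ⟨h1, h2⟩ E ⟨a, ha, b, hb, rfl⟩
    ext x
    rw [errorOp_apply, h2 a ha]
    by_cases hx : x ∈ C
    · have h3 : ∑ i, b i * (x i - a i) = 0 := (hC (x - a)).1 (C.sub_mem hx (hDC ha)) b hb
      rw [h3, AddChar.map_zero_eq_one, one_mul]
    · rw [h1 x hx, mul_zero]
  · intro h
    refine ⟨fun x hx => ?_, fun a ha x => ?_⟩
    · rw [hC] at hx
      push Not at hx
      obtain ⟨b, hb, hbx⟩ := hx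
      have h1 := congrArg (fun φ : QuditSpace p ι => φ x) (h _ ⟨0, D.zero_mem, b, hb, rfl⟩)
      simp only [errorOp_apply, Pi.zero_apply, sub_zero] at h1
      by_contra h0
      exact stdAddChar_ne_one hbx (mul_right_cancel₀ h0 (h1.trans (one_mul _).symm))
    · have h1 := congrArg (fun φ : QuditSpace p ι => φ x) (h _ ⟨a, ha, 0, D.zero_mem, rfl⟩)
      simpa [errorOp_apply] using h1

/-- If `a ∉ C`, the shift moves the support off `C`. If `b ∉ C`, some `d ∈ D` has `b · d ≠ 0`, and
translating the summation variable by `d` multiplies the inner product by a root of unity other than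
1. -/
theorem inner_errorOp_cssCode (hC : ∀ x, x ∈ C ↔ ∀ d ∈ D, ∑ i, d i * x i = 0)
    {a b : ι → ZMod p} (hab : ¬(a ∈ C ∧ b ∈ C)) {u v : QuditSpace p ι}
    (hu : u ∈ cssCode C D) (hv : v ∈ cssCode C D) : ⟪u, errorOp a b v⟫_ℂ = 0 := by
  rw [PiLp.inner_apply]
  by_cases ha : a ∈ C
  · have hb : b ∉ C := fun hb => hab ⟨ha, hb⟩
    rw [hC] at hb
    push Not at hb
    obtain ⟨d, hd, hdb⟩ := hb
    have hbd : ∑ i, b i * d i ≠ 0 := by simpa only [mul_comm] using hdb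
    set F : (ι → ZMod p) → ℂ := fun x => ⟪u x, errorOp a b v x⟫_ℂ with hF
    have hshift : ∀ x, F (x + d) = ZMod.stdAddChar (∑ i, b i * d i) * F x := by
      intro x
      have h1 : u (x + d) = u x := by simpa using (hu.2 d hd (x + d)).symm
      have h2 : v (x + d - a) = v (x - a) := by
        have := hv.2 d hd (x + d - a)
        rw [← this, show x + d - a - d = x - a by abel]
      have h3 : ∑ i, b i * ((x + d) i - a i) = ∑ i, b i * d i + ∑ i, b i * (x i - a i) := by
        rw [← Finset.sum_add_distrib]
        exact Finset.sum_congr rfl fun i _ => by simp only [Pi.add_apply]; ring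
      simp only [hF, errorOp_apply, h1, h2, h3, AddChar.map_add_eq_mul, RCLike.inner_apply]
      ring
    have hsum : ∑ x, F x = ZMod.stdAddChar (∑ i, b i * d i) * ∑ x, F x := by
      rw [Finset.mul_sum, ← Equiv.sum_comp (Equiv.addRight d) F]
      exact Finset.sum_congr rfl fun x _ => hshift x
    by_contra h0
    exact stdAddChar_ne_one hbd (mul_right_cancel₀ h0 (hsum.symm.trans (one_mul _).symm))
  · refine Finset.sum_eq_zero fun x _ => ?_
    by_cases hx : x ∈ C
    · have hxa : x - a ∉ C := fun h => ha (by simpa using C.sub_mem hx h)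
      rw [errorOp_apply, hv.1 _ hxa, mul_zero, inner_zero_right]
    · rw [hu.1 x hx, inner_zero_left]

theorem cssCode_isPureTo (hC : ∀ x, x ∈ C ↔ ∀ d ∈ D, ∑ i, d i * x i = 0) {d : ℕ}
    (hd : HasMinDistance C d) : IsPureTo (cssCode C D) d := by
  intro a b h0 hlt u hu v hv
  refine inner_errorOp_cssCode hC (fun ⟨ha, hb⟩ => ?_) hu hv
  have h1 : a = 0 := by
    by_contra hne
    exact absurd ((hd.2 ⟨a, ha, hne, rfl⟩).trans (hammingNorm_le_errorWeight_left a b)) hlt.not_ge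
  have h2 : b = 0 := by
    by_contra hne
    exact absurd ((hd.2 ⟨b, hb, hne, rfl⟩).trans (hammingNorm_le_errorWeight_right a b)) hlt.not_ge
  simp [h1, h2, errorWeight] at h0

open Classical in
/-- The uniform superposition of the words of the coset `a + D`. -/
noncomputable def cosetState (D : Submodule (ZMod p) (ι → ZMod p)) (a : ι → ZMod p) :
    QuditSpace p ι :=
  WithLp.toLp 2 fun x => if x - a ∈ D then 1 else 0

theorem cosetState_apply_self (a : ι → ZMod p) : cosetState D a a = 1 := by
  simp [cosetState]

theorem cosetState_mem_cssCode (hDC : D ≤ C) {a : ι → ZMod p} (ha : a ∈ C) :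
    cosetState D a ∈ cssCode C D := by
  refine ⟨fun x hx => ?_, fun d hd x => ?_⟩
  · have : x - a ∉ D := fun h => hx (by simpa using C.add_mem (hDC h) ha)
    simp [cosetState, this]
  · have : x - d - a ∈ D ↔ x - a ∈ D := by
      rw [sub_right_comm]
      exact D.sub_mem_iff_left hd
    classical exact if_congr this rfl rfl

theorem errorOp_cosetState (a : ι → ZMod p) :
    errorOp a 0 (cosetState D 0) = cosetState D a := by
  ext x
  have h : cosetState D 0 (x - a) = cosetState D a x := by
    have h1 : x - a - 0 ∈ D ↔ x - a ∈ D := by rw [sub_zero]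
    classical exact if_congr h1 rfl rfl
  simp [errorOp_apply, h]

theorem inner_cosetState {a : ι → ZMod p} (ha : a ∉ D) :
    ⟪cosetState D a, cosetState D 0⟫_ℂ = 0 := by
  rw [PiLp.inner_apply]
  refine Finset.sum_eq_zero fun x _ => ?_
  by_cases hx : x ∈ D
  · have : x - a ∉ D := fun h => ha (by simpa using D.sub_mem hx h)
    simp [cosetState, this]
  · simp [cosetState, hx]

theorem inner_cosetState_self_ne_zero (a : ι → ZMod p) :
    ⟪cosetState D a, cosetState D a⟫_ℂ ≠ 0 := by
  rw [inner_self_ne_zero]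
  intro h
  have := cosetState_apply_self (D := D) a
  rw [h] at this
  simp at this

/-- A lightest word `a` of `C` bounds the distance from above. If `a ∉ D`, then `X(a)` maps the
state of `D` to the orthogonal state of `a + D`, so it is undetectable. If `a ∈ D`, then `X(a)` acts
trivially and is always detected; `hD` then supplies dimension 1, where purity is required and
fails. -/
theorem cssCode_hasQuantumDistance (hDC : D ≤ C)
    (hC : ∀ x, x ∈ C ↔ ∀ d ∈ D, ∑ i, d i * x i = 0) {d : ℕ} (hd : HasMinDistance C d)
    (hD : (∃ a ∈ D, a ≠ 0 ∧ hammingNorm a ≤ d) → Module.finrank ℂ (cssCode C D) = 1) :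
    HasQuantumDistance (cssCode C D) d := by
  have hpure := cssCode_isPureTo hC hd
  refine ⟨⟨fun a b hlt => ?_, fun _ => hpure⟩, fun e he => ?_⟩
  · rcases Nat.eq_zero_or_pos (errorWeight a b) with h0 | h0
    · have ha : a = 0 := by
        have := (hammingNorm_le_errorWeight_left a b).trans h0.le
        simpa using this
      have hb : b = 0 := by
        have := (hammingNorm_le_errorWeight_right a b).trans h0.le
        simpa using this
      exact ⟨1, fun u _ v _ => by rw [ha, hb, errorOp_zero_zero, one_mul]⟩
    · exact ⟨0, fun u hu v hv => by rw [hpure a b h0 hlt u hu v hv, zero_mul]⟩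
  · by_contra hlt
    obtain ⟨a, haC, ha0, had⟩ := hd.1
    have hw : errorWeight a 0 < e := by
      rw [errorWeight_zero_right, had]
      exact not_le.1 hlt
    have h0 := cosetState_mem_cssCode hDC C.zero_mem
    have h1 := cosetState_mem_cssCode hDC haC
    by_cases haD : a ∈ D
    · have hpos : 0 < errorWeight a 0 := by
        rw [errorWeight_zero_right]
        exact hammingNorm_pos_iff.2 ha0
      have h2 := he.2 (hD ⟨a, haD, ha0, had.le⟩) a 0 hpos hw _ h1 _ h0
      rw [errorOp_cosetState] at h2
      exact inner_cosetState_self_ne_zero a h2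
    · obtain ⟨c, hc⟩ := he.1 a 0 hw
      have h2 := hc _ h1 _ h0
      rw [errorOp_cosetState, inner_cosetState haD, mul_zero] at h2
      exact inner_cosetState_self_ne_zero a h2

end CSS

/-! ### Cyclic codes with one cyclotomic class, and uniqueness under affine invariance. -/

section CyclicCode

open Polynomial

variable {p : ℕ} [Fact p.Prime] {G : Type*} [Field G] [Fintype G] [Algebra (ZMod p) G]

omit [Fintype G] in
theorem aeval_pow_prime_pow (f : (ZMod p)[X]) (x : G) (l : ℕ) :
    aeval (x ^ p ^ l) f = aeval x f ^ p ^ l := by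
  induction l with
  | zero => simp
  | succ l ih =>
    have h := aeval_algHom_apply (FiniteField.frobeniusAlgHom (ZMod p) G) (x ^ p ^ l) f
    simp only [FiniteField.coe_frobeniusAlgHom, ZMod.card] at h
    rw [pow_succ, pow_mul, h, ih, ← pow_mul]

theorem pow_eq_pow_iff_modEq_of_isPrimitiveRoot {M : Type*} [CommMonoid M] {β : M} {n i k : ℕ}
    (hn : 0 < n) (hβ : IsPrimitiveRoot β n) : β ^ i = β ^ k ↔ i ≡ k [MOD n] := by
  have hmod : ∀ a, β ^ (a % n) = β ^ a := fun a => by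
    rw [hβ.eq_orderOf]
    exact pow_mod_orderOf β a
  rw [← hmod i, ← hmod k]
  exact ⟨hβ.pow_inj (Nat.mod_lt _ hn) (Nat.mod_lt _ hn), fun h => congrArg _ h⟩

theorem sum_eq_sum_primitiveRoot {M : Type*} [AddCommMonoid M] {β : G}
    (hβ : IsPrimitiveRoot β (Nat.card G - 1)) (f : G → M) :
    ∑ h, f h = f 0 + ∑ i : Fin (Nat.card G - 1), f (β ^ (i : ℕ)) := by
  classical
  have hβ0 : β ≠ 0 := hβ.ne_zero (Nat.sub_pos_of_lt Finite.one_lt_card).ne'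
  have : NeZero (Nat.card G - 1) := ⟨(Nat.sub_pos_of_lt Finite.one_lt_card).ne'⟩
  rw [← Finset.add_sum_erase Finset.univ f (Finset.mem_univ 0)]
  congr 1
  symm
  refine Finset.sum_bij (fun i _ => β ^ (i : ℕ)) (fun i _ => ?_) (fun i _ k _ h => ?_)
    (fun h hh => ?_) fun _ _ => rfl
  · simp [hβ0]
  · exact Fin.ext (hβ.pow_inj i.2 k.2 h)
  · have h0 : h ≠ 0 := (Finset.mem_erase.1 hh).1
    have h1 : h ^ (Nat.card G - 1) = 1 := by
      rw [Nat.card_eq_fintype_card]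
      exact FiniteField.pow_card_sub_one_eq_one h h0
    obtain ⟨i, hi, rfl⟩ := hβ.eq_pow_of_pow_eq_one h1
    exact ⟨⟨i, hi⟩, Finset.mem_univ _, rfl⟩

omit [Fintype G] in
/-- A generator polynomial whose zeros form one cyclotomic class is the minimal polynomial
of any of its zeros, up to a unit. -/
theorem dvd_iff_of_definingSet_eq_cyclotomicClass {β : G} {n j : ℕ} (hβ : IsPrimitiveRoot β n)
    (hj : j < n) {g : (ZMod p)[X]} (hg : g ∣ X ^ n - 1)
    (hT : definingSet n β g = cyclotomicClass p n j) (f : (ZMod p)[X]) :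
    g ∣ f ↔ aeval (β ^ j) f = 0 := by
  have hn : NeZero n := ⟨(Nat.zero_lt_of_lt hj).ne'⟩
  constructor
  · rintro ⟨q, rfl⟩
    have h : j ∈ definingSet n β g := by
      rw [hT]
      exact ⟨hj, 0, by simpa using Nat.ModEq.refl j⟩
    rw [map_mul, h.2, zero_mul]
  · intro hf
    rcases eq_or_ne f 0 with rfl | hf0
    · exact dvd_zero g
    -- Over `G`, the divisor `g` of `X ^ n - 1` splits with simple roots, so it suffices that each
    -- of its roots is a root of `f`; these roots are Frobenius conjugates of `β ^ j`.
    have hgG : g.map (algebraMap (ZMod p) G) ∣ X ^ n - 1 := by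
      simpa using Polynomial.map_dvd (algebraMap (ZMod p) G) hg
    have hX0 : (X ^ n - 1 : G[X]) ≠ 0 := (monic_X_pow_sub_C (1 : G) hn.out).ne_zero
    have hsplit : (X ^ n - 1 : G[X]).Splits := X_pow_sub_one_splits hβ
    have hg0 : g.map (algebraMap (ZMod p) G) ≠ 0 := ne_zero_of_dvd_ne_zero hX0 hgG
    have hnodup : (g.map (algebraMap (ZMod p) G)).roots.Nodup :=
      Multiset.nodup_of_le (roots.le_of_dvd hX0 hgG) hβ.nthRoots_one_nodup
    rw [← Polynomial.map_dvd_map' (algebraMap (ZMod p) G)]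
    refine (hsplit.of_dvd hX0 hgG).dvd_of_roots_le_roots hg0 ?_
    rw [Multiset.le_iff_subset hnodup]
    intro r hr
    have hr1 : aeval r g = 0 := by simpa [aeval_def, eval_map] using (mem_roots'.1 hr).2
    have hr2 : r ^ n = 1 := by
      obtain ⟨q, hq⟩ := hg
      have := congrArg (aeval r) hq
      rw [map_mul, hr1, zero_mul] at this
      simpa [sub_eq_zero] using this
    obtain ⟨i, hi, rfl⟩ := hβ.eq_pow_of_pow_eq_one hr2
    have hiT : i ∈ cyclotomicClass p n j := hT ▸ ⟨hi, hr1⟩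
    obtain ⟨-, l, hl⟩ := hiT
    rw [mem_roots (Polynomial.map_ne_zero hf0), IsRoot.def, eval_map, ← aeval_def,
      (pow_eq_pow_iff_modEq_of_isPrimitiveRoot (by omega) hβ).2 hl, pow_mul, aeval_pow_prime_pow, hf,
      zero_pow (pow_ne_zero _ (Fact.out : p.Prime).ne_zero)]

theorem mem_extendedCode_iff {β : G} {j : ℕ} (hβ : IsPrimitiveRoot β (Nat.card G - 1))
    (hj : j < Nat.card G - 1) {g : (ZMod p)[X]} (hg : g ∣ X ^ (Nat.card G - 1) - 1)
    (hT : definingSet (Nat.card G - 1) β g = cyclotomicClass p (Nat.card G - 1) j)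
    (x : G → ZMod p) :
    x ∈ extendedCode β (cyclicCode (ZMod p) (Nat.card G - 1) g) ↔
      ∑ h, x h = 0 ∧
        ∑ i : Fin (Nat.card G - 1), x (β ^ (i : ℕ)) • (β ^ (i : ℕ)) ^ j = 0 := by
  rw [sum_eq_sum_primitiveRoot hβ x, ← eq_neg_iff_add_eq_zero, and_comm]
  refine and_congr ?_ Iff.rfl
  change g ∣ _ ↔ _
  rw [dvd_iff_of_definingSet_eq_cyclotomicClass hβ hj hg hT, map_sum]
  simp only [map_mul, aeval_C, map_pow, aeval_X, Algebra.smul_def, ← pow_mul, mul_comm j]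

/-- For `j ≠ 0` the point `h = 0` adds nothing to the power sum, so the sum may run over all of `G`;
with `0 ^ 0 = 1` this breaks down at `j = 0`. -/
theorem mem_extendedCode_iff_of_pos {β : G} {j : ℕ} (hβ : IsPrimitiveRoot β (Nat.card G - 1))
    (hj : j < Nat.card G - 1) (hj0 : j ≠ 0) {g : (ZMod p)[X]}
    (hg : g ∣ X ^ (Nat.card G - 1) - 1)
    (hT : definingSet (Nat.card G - 1) β g = cyclotomicClass p (Nat.card G - 1) j)
    (x : G → ZMod p) :
    x ∈ extendedCode β (cyclicCode (ZMod p) (Nat.card G - 1) g) ↔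
      ∑ h, x h = 0 ∧ ∑ h, x h • h ^ j = 0 := by
  rw [mem_extendedCode_iff hβ hj hg hT, sum_eq_sum_primitiveRoot hβ fun h => x h • h ^ j,
    zero_pow hj0, smul_zero, zero_add]

theorem isExtendedCyclicCode_affineCheckCode (hG : 2 < Nat.card G) {β : G}
    (hβ : IsPrimitiveRoot β (Nat.card G - 1)) :
    IsExtendedCyclicCode β (cyclotomicClass p (Nat.card G - 1) 1) (affineCheckCode p G) := by
  have hn : 1 < Nat.card G - 1 := by omega
  have hint : IsIntegral (ZMod p) β := Algebra.IsIntegral.isIntegral β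
  have hdvd : minpoly (ZMod p) β ∣ X ^ (Nat.card G - 1) - 1 :=
    minpoly.dvd _ _ (by rw [map_sub, map_pow, aeval_X, hβ.pow_eq_one, map_one, sub_self])
  have hT : definingSet (Nat.card G - 1) β (minpoly (ZMod p) β) =
      cyclotomicClass p (Nat.card G - 1) 1 := by
    ext i
    refine and_congr Iff.rfl ⟨fun h => ?_, ?_⟩
    · have hconj : IsConjRoot (ZMod p) β (β ^ i) :=
        isConjRoot_of_aeval_eq_zero hint h
      -- Every conjugate of `β` is a Frobenius power of it, since Frobenius generates the Galois
      -- group.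
      obtain ⟨σ, hσ⟩ := isConjRoot_iff_exists_algEquiv.1 hconj.symm
      obtain ⟨l, rfl⟩ := (FiniteField.bijective_frobeniusAlgEquivOfAlgebraic_pow (ZMod p) G).2 σ
      refine ⟨l, ?_⟩
      rw [one_mul, ← (pow_eq_pow_iff_modEq_of_isPrimitiveRoot (by omega) hβ), ← hσ]
      simp only [AlgEquiv.coe_pow, FiniteField.coe_frobeniusAlgEquivOfAlgebraic_iterate, ZMod.card]
    · rintro ⟨l, hl⟩
      rw [(pow_eq_pow_iff_modEq_of_isPrimitiveRoot (by omega) hβ).2 hl, one_mul, aeval_pow_prime_pow, minpoly.aeval,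
        zero_pow (pow_ne_zero _ (Fact.out : p.Prime).ne_zero)]
  refine ⟨hβ, minpoly (ZMod p) β, hdvd, hT, ?_⟩
  ext x
  rw [mem_extendedCode_iff_of_pos hβ hn one_ne_zero hdvd hT, mem_affineCheckCode]
  simp only [pow_one]

variable (p G) in
theorem isAffineInvariant_affineCheckCode : IsAffineInvariant (affineCheckCode p G) := by
  intro a b ha x hx
  rw [mem_affineCheckCode] at hx ⊢
  obtain ⟨h1, h2⟩ := hx
  let e : G ≃ G := (Equiv.mulLeft₀ a ha).trans (Equiv.addRight b)
  have he : ∀ g, e g = a * g + b := fun g => rfl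
  have h3 : ∑ h, x (a * h + b) = 0 := by
    simpa only [← he, Equiv.sum_comp e] using h1
  refine ⟨h3, ?_⟩
  have h4 : ∑ h, x (a * h + b) • (a * h + b) = 0 := by
    have := Equiv.sum_comp e fun h => x h • h
    simpa only [he, h2] using this
  simp only [smul_add, Finset.sum_add_distrib, ← Finset.sum_smul, h3, zero_smul, add_zero,
    ← mul_smul_comm, ← Finset.mul_sum] at h4
  exact (mul_eq_zero.1 h4).resolve_left ha

theorem exists_isPrimitiveRoot_card_sub_one (G : Type*) [Field G] [Fintype G] :
    ∃ β : G, IsPrimitiveRoot β (Nat.card G - 1) := by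
  obtain ⟨u, hu⟩ := IsCyclic.exists_generator (α := Gˣ)
  refine ⟨u, ?_⟩
  rw [IsPrimitiveRoot.coe_units_iff, ← Nat.card_units, ← orderOf_eq_card_of_forall_mem_zpowers hu]
  exact IsPrimitiveRoot.orderOf u

theorem isMaximalAffineInvariantCode_affineCheckCode (hG : 2 < Nat.card G) :
    IsMaximalAffineInvariantCode (affineCheckCode p G) := by
  obtain ⟨β, hβ⟩ := exists_isPrimitiveRoot_card_sub_one G
  refine ⟨⟨β, 1, by omega, ?_⟩, isAffineInvariant_affineCheckCode p G⟩
  rw [Nat.card_zmod]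
  exact isExtendedCyclicCode_affineCheckCode hG hβ

theorem isExtendedBCHCode_affineCheckCode (hG : 2 < Nat.card G) :
    IsExtendedBCHCode 2 (affineCheckCode p G) := by
  obtain ⟨β, hβ⟩ := exists_isPrimitiveRoot_card_sub_one G
  refine ⟨β, ?_⟩
  have h : {s | ∃ i, 1 ≤ i ∧ i < 2 ∧ s ∈ cyclotomicClass (Nat.card (ZMod p)) (Nat.card G - 1) i} =
      cyclotomicClass p (Nat.card G - 1) 1 := by
    ext s
    rw [Nat.card_zmod]
    constructor
    · rintro ⟨i, h1, h2, h3⟩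
      rwa [show i = 1 by omega] at h3
    · intro h
      exact ⟨1, le_rfl, by omega, h⟩
  rw [h]
  exact isExtendedCyclicCode_affineCheckCode hG hβ

/-- If the power sum of exponent `j` vanishes on all translates of `x`, then so does the linear
one, provided that the prime does not divide `j`. -/
theorem sum_smul_eq_zero_of_translates {j : ℕ} (hj : j < Fintype.card G) (hpj : ¬p ∣ j)
    {x : G → ZMod p} (hx : ∀ b, ∑ h, x h • (h + b) ^ j = 0) : ∑ h, x h • h = 0 := by
  have hj0 : j ≠ 0 := by
    rintro rfl
    exact hpj (dvd_zero p)
  -- As a polynomial in the translation `b`, the power sum has degree below `|G|` and vanishes on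
  -- `G`, so it is zero. Its coefficient at `b^(j-1)` is `j * ∑ x_h h`.
  let P : G[X] := ∑ h, C (algebraMap (ZMod p) G (x h)) * (X + C h) ^ j
  have hdeg : P.natDegree < Fintype.card G := by
    refine lt_of_le_of_lt (natDegree_sum_le_of_forall_le _ _ fun h _ => ?_) hj
    refine (natDegree_C_mul_le _ _).trans ?_
    rw [natDegree_pow, natDegree_X_add_C, mul_one]
  have hP : P = 0 := by
    refine eq_zero_of_natDegree_lt_card_of_eval_eq_zero P (f := id) Function.injective_id
      (fun b => ?_) hdeg
    rw [id, eval_finsetSum, ← hx b]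
    refine Finset.sum_congr rfl fun h _ => ?_
    simp [Algebra.smul_def, add_comm]
  have hc := congrArg (fun q : G[X] => q.coeff (j - 1)) hP
  simp only [P, finsetSum_coeff, coeff_C_mul, coeff_X_add_C_pow, coeff_zero] at hc
  rw [Nat.sub_sub_self (Nat.pos_of_ne_zero hj0), Nat.choose_symm (Nat.pos_of_ne_zero hj0),
    Nat.choose_one_right] at hc
  simp only [pow_one, ← mul_assoc, ← Finset.sum_mul, ← Algebra.smul_def] at hc
  refine (mul_eq_zero.1 hc).resolve_right fun h => hpj ?_
  have : CharP G p := charP_of_injective_algebraMap (algebraMap (ZMod p) G).injective p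
  exact (CharP.cast_eq_zero_iff G p j).1 h

theorem sum_smul_pow_prime_pow (x : G → ZMod p) (f : G → G) (l : ℕ) :
    ∑ h, x h • f h ^ p ^ l = (∑ h, x h • f h) ^ p ^ l := by
  have : CharP G p := charP_of_injective_algebraMap (algebraMap (ZMod p) G).injective p
  rw [sum_pow_char_pow]
  refine Finset.sum_congr rfl fun h _ => ?_
  rw [Algebra.smul_def, Algebra.smul_def, mul_pow, ← map_pow, ZMod.pow_card_pow]

theorem eq_affineCheckCode (hG : 2 < Nat.card G) {E : Submodule (ZMod p) (G → ZMod p)}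
    (hE : IsMaximalAffineInvariantCode E) : E = affineCheckCode p G := by
  classical
  obtain ⟨⟨β, j, hj, hβ, g, hg, hT, rfl⟩, hinv⟩ := hE
  rw [Nat.card_zmod] at hT
  -- For `j = 0` the code is `∑ x_h = 0`, `x_0 = 0`. Translating `δ_1 - δ_β` by 1 puts a nonzero
  -- entry at 0.
  have hj0 : j ≠ 0 := by
    rintro rfl
    have hβ1 : β ≠ 1 := hβ.ne_one (by omega)
    have hβ0 : β ≠ 0 := hβ.ne_zero (by omega)
    have h1 : ∀ x : G → ZMod p, x ∈ extendedCode β (cyclicCode (ZMod p) (Nat.card G - 1) g) ↔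
        ∑ h, x h = 0 ∧ x 0 = 0 := by
      intro x
      rw [mem_extendedCode_iff hβ hj hg hT]
      refine and_congr_right fun hx => ?_
      rw [sum_eq_sum_primitiveRoot hβ, ← eq_neg_iff_add_eq_zero] at hx
      simp only [pow_zero, ← Finset.sum_smul, smul_eq_zero, one_ne_zero, or_false]
      rw [hx, neg_eq_zero]
    have h2 := hinv 1 1 one_ne_zero (Pi.single 1 1 - Pi.single β 1) ((h1 _).2 ⟨by
      simp [Finset.sum_sub_distrib], by simp [hβ0.symm]⟩)
    have h3 := ((h1 _).1 h2).2
    simp [hβ1.symm] at h3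
  have hmem := mem_extendedCode_iff_of_pos hβ hj hj0 hg hT
  have hle : extendedCode β (cyclicCode (ZMod p) (Nat.card G - 1) g) ≤ affineCheckCode p G := by
    intro x hx
    rw [mem_affineCheckCode]
    refine ⟨((hmem x).1 hx).1, ?_⟩
    -- With `j = p^l j'`, the power sum of exponent `j` is the `p^l`-th power of that of exponent
    -- `j'`, because Frobenius fixes the entries of `x`.
    obtain ⟨l, j', hpj, hjj⟩ := Nat.exists_eq_pow_mul_and_not_dvd hj0 p (Fact.out : p.Prime).ne_one
    have hj'0 : j' ≠ 0 := by
      rintro rfl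
      exact hpj (dvd_zero p)
    have hj' : j' < Fintype.card G := by
      rw [← Nat.card_eq_fintype_card]
      have : j' ≤ j := hjj ▸ Nat.le_mul_of_pos_left _ (pow_pos (Fact.out : p.Prime).pos l)
      omega
    refine sum_smul_eq_zero_of_translates hj' hpj fun b => ?_
    have h1 := ((hmem _).1 (hinv 1 (-b) one_ne_zero x hx)).2
    rw [← Equiv.sum_comp (Equiv.addRight b)] at h1
    simp only [Equiv.coe_addRight, one_mul, add_neg_cancel_right] at h1
    rw [hjj, mul_comm] at h1
    simp only [pow_mul] at h1
    rw [sum_smul_pow_prime_pow x fun h => (h + b) ^ j'] at h1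
    exact pow_eq_zero_iff (pow_ne_zero _ (Fact.out : p.Prime).ne_zero) |>.1 h1
  refine Submodule.eq_of_le_of_finrank_le hle ?_
  -- The code is the kernel of a map into a space of dimension `1 + m`, so its dimension is at least
  -- that of `affineCheckCode`.
  let φ : (G → ZMod p) →ₗ[ZMod p] ZMod p × G :=
    { toFun x := (∑ h, x h, ∑ h, x h • h ^ j)
      map_add' x y := by simp [Finset.sum_add_distrib, add_smul]
      map_smul' c x := by simp [Finset.mul_sum, Finset.smul_sum, mul_smul] }
  have hφ : extendedCode β (cyclicCode (ZMod p) (Nat.card G - 1) g) = LinearMap.ker φ := by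
    ext x
    rw [hmem, LinearMap.mem_ker]
    exact Prod.mk_eq_zero.symm
  have h1 := LinearMap.finrank_range_add_finrank_ker φ
  have h2 := Submodule.finrank_le (LinearMap.range φ)
  have h3 := finrank_affineCheckCode (p := p) (G := G)
  rw [Module.finrank_prod, Module.finrank_self] at h2
  rw [Module.finrank_fintype_fun_eq_card] at h1
  rw [hφ]
  omega

end CyclicCode
-- Assembly of the main theorem.
theorem mainTheorem4 (p m : ℕ) [Fact p.Prime] (hm : 0 < m) (hpm : 3 < p ∨ 2 < m)
    (G : Type*) [Field G] [Fintype G] [DecidableEq G] [Algebra (ZMod p) G]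
    (hG : Fintype.card G = p ^ m) :
    (∃ E : Submodule (ZMod p) (G → ZMod p), IsMaximalAffineInvariantCode E) ∧
    ∀ E : Submodule (ZMod p) (G → ZMod p), IsMaximalAffineInvariantCode E →
      IsExtendedBCHCode 2 E ∧
      (HasMinDistance (euclideanDual E) (p ^ m - p ^ (m - 1)) ∨
        HasMinDistance (euclideanDual E) (p ^ m - p ^ (m - 1) + 1)) ∧
      ∃ (k dA dQ : ℕ) (Q : Submodule ℂ (QuditSpace p G)),
        (k : ℤ) = (p : ℤ) ^ m - 2 - 2 * m ∧
        HasMinDistance E dA ∧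
        IsQuantumCode Q (p ^ m) k dQ ∧
        IsPureQuantumCode Q ∧
        dQ ≤ m + 2 ∧ dQ = dA := by
  have hp : p.Prime := Fact.out
  have hp2 := hp.two_le
  have hfin := finrank_of_card_eq hG
  have hmm : p ^ m = p * p ^ (m - 1) := by rw [← pow_succ', Nat.sub_add_cancel hm]
  have hcard : 2 < Nat.card G := by
    rw [Nat.card_eq_fintype_card, hG]
    rcases hpm with h | h
    · exact (by omega : 2 < p).trans_le (Nat.le_self_pow hm.ne' p)
    · calc 2 < 2 ^ 3 := by norm_num
        _ ≤ p ^ 3 := Nat.pow_le_pow_left hp2 3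
        _ ≤ p ^ m := Nat.pow_le_pow_right hp.pos h
  refine ⟨⟨_, isMaximalAffineInvariantCode_affineCheckCode hcard⟩, fun E hE => ?_⟩
  obtain rfl := eq_affineCheckCode hcard hE
  refine ⟨isExtendedBCHCode_affineCheckCode hcard, Or.inl ?_, ?_⟩
  · rw [euclideanDual_affineCheckCode]
    exact hasMinDistance_affineFunctionCode hm hG
  have hDC : affineFunctionCode p G ≤ affineCheckCode p G :=
    affineFunctionCode_le (by rwa [hfin])
  have hC : ∀ x, x ∈ affineCheckCode p G ↔ ∀ d ∈ affineFunctionCode p G, ∑ h, d h * x h = 0 :=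
    fun x => mem_affineCheckCode_iff_forall
  have h1 := finrank_affineCheckCode (p := p) (G := G)
  have h2 := finrank_affineFunctionCode (p := p) (G := G)
  have h3 := Submodule.finrank_mono hDC
  have hrank := finrank_cssCode hDC
  rw [hfin] at h1 h2
  rw [hG] at h1
  -- `hlow`: words of weight `d` of `C` lie in the subcode `D` only if the quantum code is trivial
  obtain ⟨d, hd, hdm, hlow⟩ : ∃ d, HasMinDistance (affineCheckCode p G) d ∧ d ≤ m + 2 ∧
      (p ^ m - p ^ (m - 1) ≤ d → p ^ m = 2 * m + 2) := by
    rcases eq_or_ne p 2 with rfl | hp'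
    · have hm2 : 2 < m := by omega
      refine ⟨4, hasMinDistance_affineCheckCode_two (by rwa [← Nat.card_eq_fintype_card]),
        by omega, fun h => ?_⟩
      -- Here `2^(m-1) ≤ 4`: this is the self-dual extended Hamming code of length 8.
      have hm3 : m = 3 := by
        by_contra hne
        have : 2 ^ 3 ≤ 2 ^ (m - 1) := Nat.pow_le_pow_right two_pos (by omega)
        omega
      subst hm3
      norm_num
    · refine ⟨3, hasMinDistance_affineCheckCode_of_ne_two hp', by omega, fun h => ?_⟩
      exfalso
      have hp3 : 3 ≤ p := by omega
      have h5 : p ^ m - p ^ (m - 1) = (p - 1) * p ^ (m - 1) := by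
        rw [hmm, Nat.sub_mul, one_mul]
      rw [h5] at h
      rcases hpm with h6 | h6
      · have := (Nat.le_mul_of_pos_right (p - 1) (pow_pos hp.pos (m - 1))).trans h
        obtain rfl : p = 4 := by omega
        exact absurd hp (by norm_num)
      · have h7 : 3 ≤ p ^ (m - 1) := hp3.trans (Nat.le_self_pow (by omega) p)
        have := (Nat.mul_le_mul (show 2 ≤ p - 1 by omega) h7).trans h
        omega
  have hdist : HasQuantumDistance (cssCode (affineCheckCode p G) (affineFunctionCode p G)) d := by
    refine cssCode_hasQuantumDistance hDC hC hd ?_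
    rintro ⟨a, ha, ha0, had⟩
    -- A word of `D` of weight at most `d` forces `p^m = 2m + 2`, that is `dim C = dim D`.
    have h4 := hlow ((le_hammingNorm_of_mem_affineFunctionCode hm hG ha ha0).trans had)
    rw [hrank, show Module.finrank (ZMod p) (affineCheckCode p G) -
      Module.finrank (ZMod p) (affineFunctionCode p G) = 0 by omega, pow_zero]
  refine ⟨_, d, d, cssCode (affineCheckCode p G) (affineFunctionCode p G), ?_, hd,
    ⟨hG, cssCode_isStabilizerCode hDC hC, hrank, hdist⟩, ⟨d, hdist, cssCode_isPureTo hC hd⟩,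
    hdm, rfl⟩
  -- The truncated subtraction in `k` is exact because `dim D ≤ dim C`.
  have h4 : (p : ℤ) ^ m = ((p ^ m : ℕ) : ℤ) := by push_cast; rfl
  rw [h4]
  omega
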